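/- **Setting.** Let $\rho$ be a density matrix and $O$ a Hermitian observable on $n$ qubits. Consider the circuit $U(\vec\theta)=\prod_{l=1}^M V_l\,e^{-i\theta_{S(l)}H_l}$ (ordered product, $l=1$ leftmost) with fixed unitaries $V_l$, Hermitian generators $H_l$, parameters $\vec\theta\in\mathbb R^m$, and an arbitrary map $S:\{1,\dots,M\}\to\{1,\dots,m\}$, so that several generators may share a parameter. Let $\mathcal L(\vec\theta)=\mathrm{Tr}[U(\vec\theta)\rho U(\vec\theta)^\dagger O]$, let $\|\cdot\|$ be the operator norm, and for $\vec\phi\in\mathbb R^m$ and $p\in\{1,\dots,m\}$ put $$c_p(\vec\phi)=\Big|\tfrac{\partial^2\mathcal L}{\partial\theta_p^2}(\vec\phi)\Big|,\qquad \omega_q=\sum_{l\in S^{-1}(q)}\big(\lambda_{\max}(H_l)-\lambda_{\min}(H_l)\big),$$ $$r_{\rm patch}^2=\frac{9\,c_p(\vec\phi)^2}{8\big(16\,c_p(\vec\phi)\|O\|\omega_p^2\sum_{q\ne p}\omega_q^2+32\|O\|^2\omega_p^6\big)}$$ (with the convention $r_{\rm patch}=0$ if the denominator vanishes). $\mathrm{Var}_r$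 denotes the variance of $\mathcal L(\vec\theta)$ for $\vec\theta$ uniform on the hypercube $\prod_i[\phi_i-r,\phi_i+r]$. **(1)** For all $n,m,M$, all such data, every $\vec\phi$, every parameter $p$ and every $r>0$ with $r^2\le r_{\rm patch}^2$, $$\mathrm{Var}_r\ \ge\ \frac{r^4}{45}\Big[\Big(c_p(\vec\phi)-\tfrac83\|O\|\omega_p^2\big(\textstyle\sum_{q\ne p}\omega_q^2\big)r^2\Big)^2-\tfrac{32}{3}\|O\|^2\omega_p^6r^2\Big]\ \ge\ \frac1{72}c_p(\vec\phi)^2r^4 .$$ In particular, this holds for $r=r_{\rm patch}$ when $r_{\rm patch}>0$. **(2)** For every $a\in\mathbb N$ there is $k_0\in\mathbb N$ such that for every integer $k\ge k_0$ there is $j\in\mathbb N$ with the following property. Take any family of such data indexed by the number $n$ of qubits, with arbitrary $m=m(n)$, $M=M(n)$, points $\vec\phi=\vec\phi(n)$ and parameters $p=p(n)$, such that as $n\to\infty$: $\|O\|\in\mathcal O(n^a)$; $\|H_l\|\in\mathcal O(n^a)$ uniformly in $l$; each parameter is shared by at most $\mathcal O(n^a)$ generators, uniformly over the parameters; and $c_p(\vec\phi)\in\Omega(n^{-a})$.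 Then for every choice of $r=r(n)>0$ with $r\in\Theta\big(\tfrac1{n^k\sqrt m}\big)$, $$\mathrm{Var}_r\in\Omega\Big(\frac1{n^j\,m^2}\Big).$$ -/

import Mathlib

section

open scoped ComplexOrder

/-- Linear operators on the Hilbert space of `n` qubits, as matrices in the computational basis
(basis vectors are bit strings of length `n`, so the dimension is `2 ^ n`). -/
abbrev QubitOp (n : ℕ) : Type := Matrix (Fin n → Fin 2) (Fin n → Fin 2) ℂ

/-- The operator (spectral) norm of an operator on `n` qubits. -/
noncomputable def QubitOp.opNorm {n : ℕ} (A : QubitOp n) : ℝ :=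
  ‖Matrix.toEuclideanCLM (n := Fin n → Fin 2) (𝕜 := ℂ) A‖

/-- The maximal frequency of a Hermitian generator: largest minus smallest eigenvalue. -/
noncomputable def QubitOp.maxFreq {n : ℕ} (H : QubitOp n) (hH : H.IsHermitian) : ℝ :=
  (⨆ i, hH.eigenvalues i) - ⨅ i, hH.eigenvalues i

/-- The data of a variational loss on `n` qubits with `m` parameters and `M` gates:
an input state, an observable, fixed unitaries, Hermitian generators, and the map assigning to
each gate the parameter that drives it (several gates may share a parameter). -/
structure QuantumLoss (n m M : ℕ) where
  /-- input state -/
  rho : QubitOp n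
  rho_posSemidef : rho.PosSemidef
  rho_trace : rho.trace = 1
  /-- observable -/
  O : QubitOp n
  O_hermitian : O.IsHermitian
  /-- fixed unitaries -/
  V : Fin M → QubitOp n
  V_unitary : ∀ l, V l ∈ Matrix.unitaryGroup (Fin n → Fin 2) ℂ
  /-- generators -/
  H : Fin M → QubitOp n
  H_hermitian : ∀ l, (H l).IsHermitian
  /-- parameter used by each gate -/
  S : Fin M → Fin m

namespace QuantumLoss

/-- The rotation `exp (-i t H_l)`. -/
noncomputable def gate {n m M : ℕ} (Q : QuantumLoss n m M) (l : Fin M) (t : ℝ) : QubitOp n :=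
  NormedSpace.exp ((-Complex.I * (t : ℂ)) • Q.H l)

/-- The circuit `V_1 U_1 V_2 U_2 ⋯ V_M U_M`, an ordered product with `U_l = exp (-i θ_{S(l)} H_l)`. -/
noncomputable def circuit {n m M : ℕ} (Q : QuantumLoss n m M) (θ : Fin m → ℝ) : QubitOp n :=
  (List.ofFn fun l : Fin M => Q.V l * Q.gate l (θ (Q.S l))).prod

/-- The loss `Tr[U(θ) ρ U(θ)† O]` (this trace is real, see `loss_eq_trace`). -/
noncomputable def loss {n m M : ℕ} (Q : QuantumLoss n m M) (θ : Fin m → ℝ) : ℝ :=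
  (Q.circuit θ * Q.rho * (Q.circuit θ).conjTranspose * Q.O).trace.re

theorem loss_eq_trace {n m M : ℕ} (Q : QuantumLoss n m M) (θ : Fin m → ℝ) :
    (Q.loss θ : ℂ) = (Q.circuit θ * Q.rho * (Q.circuit θ).conjTranspose * Q.O).trace := by
  apply Complex.conj_eq_iff_re.mp
  change star _ = _
  rw [← Matrix.trace_conjTranspose]
  simp only [Matrix.conjTranspose_mul, Matrix.conjTranspose_conjTranspose, Q.O_hermitian.eq,
    Q.rho_posSemidef.isHermitian.eq]
  rw [Matrix.trace_mul_comm]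
  simp only [Matrix.mul_assoc]

/-- The hypercube of all `θ` with `θ i ∈ [φ i - r, φ i + r]` for every `i`. -/
def hypercube {m : ℕ} (φ : Fin m → ℝ) (r : ℝ) : Set (Fin m → ℝ) :=
  Set.Icc (fun i => φ i - r) (fun i => φ i + r)

/-- Variance of the loss when `θ` is uniform on the hypercube of half-width `r` around `φ`. -/
noncomputable def lossVariance {n m M : ℕ} (Q : QuantumLoss n m M) (φ : Fin m → ℝ) (r : ℝ) : ℝ :=
  ProbabilityTheory.variance Q.loss
    (ProbabilityTheory.cond MeasureTheory.volume (hypercube φ r))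

/-- `c_p(φ)`: absolute value of the second partial derivative of the loss in parameter `p`. -/
noncomputable def curvature {n m M : ℕ} (Q : QuantumLoss n m M) (φ : Fin m → ℝ) (p : Fin m) : ℝ :=
  |iteratedDeriv 2 (fun t : ℝ => Q.loss (Function.update φ p t)) (φ p)|

/-- `ω_q`: sum of the maximal frequencies of the generators driven by parameter `q`. -/
noncomputable def omega {n m M : ℕ} (Q : QuantumLoss n m M) (q : Fin m) : ℝ :=
  ∑ l ∈ Finset.univ.filter (fun l => Q.S l = q), QubitOp.maxFreq (Q.H l) (Q.H_hermitian l)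

/-- The sum of `ω_q ^ 2` over all parameters `q ≠ p`. -/
noncomputable def otherOmegaSq {n m M : ℕ} (Q : QuantumLoss n m M) (p : Fin m) : ℝ :=
  ∑ q ∈ Finset.univ.filter (fun q => q ≠ p), Q.omega q ^ 2

/-- The squared patch radius `r_patch ^ 2` at `φ` for parameter `p`. -/
noncomputable def patchRadiusSq {n m M : ℕ} (Q : QuantumLoss n m M) (φ : Fin m → ℝ)
    (p : Fin m) : ℝ :=
  9 * Q.curvature φ p ^ 2 /
    (8 * (16 * Q.curvature φ p * Q.O.opNorm * Q.omega p ^ 2 * Q.otherOmegaSq p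
      + 32 * Q.O.opNorm ^ 2 * Q.omega p ^ 6))

/-- The explicit lower bound on the variance. -/
noncomputable def varianceBound {n m M : ℕ} (Q : QuantumLoss n m M) (φ : Fin m → ℝ)
    (p : Fin m) (r : ℝ) : ℝ :=
  r ^ 4 / 45 *
    ((Q.curvature φ p - 8 / 3 * Q.O.opNorm * Q.omega p ^ 2 * Q.otherOmegaSq p * r ^ 2) ^ 2
      - 32 / 3 * Q.O.opNorm ^ 2 * Q.omega p ^ 6 * r ^ 2)

end QuantumLoss

end

open Function

/-! Conjugating the observable by the circuit makes each partial derivative of the loss cheap. A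
rotation may be generated by its Hamiltonian shifted to the midpoint of the spectrum, of norm at
most half the maximal frequency, since the phase this costs cancels between `U` and `U†`. The
product rule then bounds the derivative in directions `q₁, …, q_j` by `‖O‖ ω_{q₁} ⋯ ω_{q_j}`
(`QuantumLoss.loss_partialsBounded`).

Given such bounds, quantum structure is no longer needed. Let `P = (y p - φ p) ^ 2 - r ^ 2 / 3`,
which has mean zero and variance `4 r ^ 4 / 45` on the cube. By Cauchy–Schwarz, the variance of `f`
is at least `(∫ f P) ^ 2` divided by that number (`sq_integral_mul_quadratic_le_variance`).
Reflecting coordinate `p` about `φ p` kills the odd Taylor terms, so `∫ f P` is `2 r ^ 4 / 45` times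
an averaged second derivative `d`, up to a fourth-order remainder. Reflecting the other coordinates
one at a time shows that `d` differs from the second derivative at `φ` by `O(r ^ 2)`
(`PartialsBounded.abs_integral_piecewise_sub_le`). Assembling these gives
`PartialsBounded.variance_uniformBox_ge`.

The patch radius is where the two losses together take at most `3/8` of `c_p ^ 2`. For the
asymptotic statement, `k ≥ 8 a + 1` puts the radius inside the patch eventually, and `c_p ^ 2 r ^ 4
/ 72` gives the rate. -/

/-- `f` is continuous, all its iterated partial derivatives up to order `k` exist and are
continuous, and the one in directions `q₁, …, q_j` is bounded by `C * w q₁ * ⋯ * w q_j`. -/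
def PartialsBounded {ι A : Type*} [DecidableEq ι] [NormedAddCommGroup A] [NormedSpace ℝ A]
    (w : ι → ℝ) : ℕ → ℝ → ((ι → ℝ) → A) → Prop
  | 0, C, f => Continuous f ∧ ∀ x, ‖f x‖ ≤ C
  | k + 1, C, f => (Continuous f ∧ ∀ x, ‖f x‖ ≤ C) ∧ ∀ q, ∃ g : (ι → ℝ) → A,
      (∀ x, HasDerivAt (fun t => f (update x q t)) (g x) (x q)) ∧
        PartialsBounded w k (C * w q) g

/-! ### Calculus of weighted bounds on iterated partial derivatives. -/

namespace PartialsBounded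

variable {ι : Type*} [DecidableEq ι]

section Normed

variable {A B : Type*} [NormedAddCommGroup A] [NormedSpace ℝ A]
  [NormedAddCommGroup B] [NormedSpace ℝ B]

theorem continuous {w : ι → ℝ} {k : ℕ} {C : ℝ} {f : (ι → ℝ) → A}
    (h : PartialsBounded w k C f) : Continuous f := by
  cases k with
  | zero => exact h.1
  | succ k => exact h.1.1

theorem norm_le {w : ι → ℝ} {k : ℕ} {C : ℝ} {f : (ι → ℝ) → A}
    (h : PartialsBounded w k C f) (x : ι → ℝ) : ‖f x‖ ≤ C := by
  cases k with
  | zero => exact h.2 x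
  | succ k => exact h.1.2 x

theorem nonneg {w : ι → ℝ} {k : ℕ} {C : ℝ} {f : (ι → ℝ) → A}
    (h : PartialsBounded w k C f) : 0 ≤ C :=
  (norm_nonneg _).trans (h.norm_le 0)

theorem of_succ {w : ι → ℝ} {k : ℕ} {C : ℝ} {f : (ι → ℝ) → A}
    (h : PartialsBounded w (k + 1) C f) : PartialsBounded w k C f := by
  induction k generalizing C f with
  | zero => exact h.1
  | succ k ih =>
    refine ⟨h.1, fun q => ?_⟩
    obtain ⟨g, hg, hg'⟩ := h.2 q
    exact ⟨g, hg, ih hg'⟩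

theorem const (w : ι → ℝ) (hw : ∀ q, 0 ≤ w q) (k : ℕ) {C : ℝ} {a : A} (ha : ‖a‖ ≤ C) :
    PartialsBounded w k C (fun _ => a) := by
  induction k generalizing C a with
  | zero => exact ⟨continuous_const, fun _ => ha⟩
  | succ k ih =>
    refine ⟨⟨continuous_const, fun _ => ha⟩, fun q => ⟨fun _ => 0, fun x => ?_, ih ?_⟩⟩
    · exact hasDerivAt_const _ _
    · simpa using mul_nonneg ((norm_nonneg _).trans ha) (hw q)

theorem add {w : ι → ℝ} {k : ℕ} {C D : ℝ} {f g : (ι → ℝ) → A}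
    (hf : PartialsBounded w k C f) (hg : PartialsBounded w k D g) :
    PartialsBounded w k (C + D) (fun x => f x + g x) := by
  have h₀ : ∀ x, ‖f x + g x‖ ≤ C + D := fun x =>
    (norm_add_le _ _).trans (add_le_add (hf.norm_le x) (hg.norm_le x))
  induction k generalizing C D f g with
  | zero => exact ⟨hf.1.add hg.1, h₀⟩
  | succ k ih =>
    refine ⟨⟨hf.continuous.add hg.continuous, h₀⟩, fun q => ?_⟩
    obtain ⟨f', hf', hf''⟩ := hf.2 q
    obtain ⟨g', hg', hg''⟩ := hg.2 q
    refine ⟨fun x => f' x + g' x, fun x => (hf' x).add (hg' x), ?_⟩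
    rw [add_mul]
    exact ih hf'' hg'' fun x =>
      (norm_add_le _ _).trans (add_le_add (hf''.norm_le x) (hg''.norm_le x))

theorem clm_comp {w : ι → ℝ} {k : ℕ} {C c : ℝ} {f : (ι → ℝ) → A} (T : A →L[ℝ] B)
    (hT : ∀ a, ‖T a‖ ≤ c * ‖a‖) (hc : 0 ≤ c) (hf : PartialsBounded w k C f) :
    PartialsBounded w k (c * C) (fun x => T (f x)) := by
  have h₀ : ∀ {D : ℝ} {f : (ι → ℝ) → A}, (∀ x, ‖f x‖ ≤ D) → ∀ x, ‖T (f x)‖ ≤ c * D :=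
    fun h x => (hT _).trans (mul_le_mul_of_nonneg_left (h x) hc)
  induction k generalizing C f with
  | zero => exact ⟨T.continuous.comp hf.1, h₀ hf.2⟩
  | succ k ih =>
    refine ⟨⟨T.continuous.comp hf.1.1, h₀ hf.1.2⟩, fun q => ?_⟩
    obtain ⟨g, hg, hg'⟩ := hf.2 q
    refine ⟨fun x => T (g x), fun x => ?_, ?_⟩
    · exact T.hasFDerivAt.comp_hasDerivAt (x q) (hg x)
    · rw [mul_assoc]
      exact ih hg'

end Normed

section Ring

variable {A : Type*} [NormedRing A] [NormedAlgebra ℝ A]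

/-- The weights behave like exponents in `exp (∑ w q * x q)`: Leibniz gives `C * v q * D + C * (D *
w q) = C * D * (v + w) q`, so they add at every order with no combinatorial constants. -/
theorem mul {v w : ι → ℝ} {k : ℕ} {C D : ℝ} {f g : (ι → ℝ) → A}
    (hf : PartialsBounded v k C f) (hg : PartialsBounded w k D g) :
    PartialsBounded (v + w) k (C * D) (fun x => f x * g x) := by
  have h₀ : ∀ x, ‖f x * g x‖ ≤ C * D := fun x =>
    (norm_mul_le _ _).trans
      (mul_le_mul (hf.norm_le x) (hg.norm_le x) (norm_nonneg _) hf.nonneg)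
  induction k generalizing C D f g with
  | zero => exact ⟨hf.1.mul hg.1, h₀⟩
  | succ k ih =>
    refine ⟨⟨hf.continuous.mul hg.continuous, h₀⟩, fun q => ?_⟩
    obtain ⟨f', hf', hf''⟩ := hf.2 q
    obtain ⟨g', hg', hg''⟩ := hg.2 q
    have hbound : ∀ {a b : (ι → ℝ) → A} {E F : ℝ}, PartialsBounded v k E a →
        PartialsBounded w k F b → ∀ x, ‖a x * b x‖ ≤ E * F := fun ha hb x =>
      (norm_mul_le _ _).trans
        (mul_le_mul (ha.norm_le x) (hb.norm_le x) (norm_nonneg _) ha.nonneg)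
    refine ⟨fun x => f' x * g x + f x * g' x, fun x => ?_, ?_⟩
    · have h := (hf' x).mul (hg' x)
      rw [update_eq_self] at h
      exact h
    · have h1 := ih hf'' hg.of_succ (hbound hf'' hg.of_succ)
      have h2 := ih hf.of_succ hg'' (hbound hf.of_succ hg'')
      have h3 := h1.add h2
      have : C * v q * D + C * (D * w q) = C * D * (v + w) q := by
        rw [Pi.add_apply]; ring
      rwa [this] at h3

/-- Each derivative in direction `s` produces one more factor `a`, while the exponential keeps norm
at most one; other directions give zero. -/
theorem exp_smul [CompleteSpace A] (s : ι) (a : A) {b : ℝ} (ha : ‖a‖ ≤ b)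
    (hexp : ∀ t : ℝ, ‖NormedSpace.exp (t • a)‖ ≤ 1) (k : ℕ) :
    PartialsBounded (Pi.single s b) k 1 (fun x : ι → ℝ => NormedSpace.exp (x s • a)) := by
  have hd := fun t : ℝ => hasDerivAt_exp_smul_const a t
  have hcont : Continuous fun x : ι → ℝ => NormedSpace.exp (x s • a) :=
    (continuous_iff_continuousAt.2 fun t => (hd t).continuousAt).comp (continuous_apply s)
  induction k with
  | zero => exact ⟨hcont, fun x => hexp _⟩
  | succ k ih =>
    refine ⟨⟨hcont, fun x => hexp _⟩, fun q => ?_⟩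
    by_cases hq : s = q
    · subst hq
      refine ⟨fun x => NormedSpace.exp (x s • a) * a, fun x => ?_, ?_⟩
      · simpa using hd (x s)
      · have := ih.mul (const (0 : ι → ℝ) (fun _ => le_rfl) k ha)
        simpa using this
    · refine ⟨fun _ => 0, fun x => ?_, ?_⟩
      · simpa [update_of_ne hq] using hasDerivAt_const (x q) (NormedSpace.exp (x s • a))
      · have hb : 0 ≤ b := (norm_nonneg _).trans ha
        refine const _ (fun r => ?_) k ?_
        · by_cases hr : r = s
          · subst hr; simpa using hb
          · simp [hr]
        · simp [Ne.symm hq]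

theorem list_prod [NormOneClass A] {α : Type*} {w : α → ι → ℝ} {k : ℕ} {f : α → (ι → ℝ) → A}
    (h : ∀ l, PartialsBounded (w l) k 1 (f l)) (L : List α) :
    PartialsBounded (L.map w).sum k 1 (fun x => (L.map fun l => f l x).prod) := by
  induction L with
  | nil => simpa using const (0 : ι → ℝ) (fun _ => le_rfl) k (norm_one (α := A)).le
  | cons l L ih => simpa using (h l).mul ih

end Ring

end PartialsBounded

/-! ### Operator norms and derivative bounds for the loss. -/

section Operators

open scoped Matrix.Norms.L2Operator ComplexOrder

namespace QubitOp

theorem opNorm_eq_norm {n : ℕ} (A : QubitOp n) : A.opNorm = ‖A‖ := rfl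

/-- Writing `ρ` as a sum of rank-one terms `v v†` turns the trace into a sum of expectation values,
each at most `‖X‖ ‖v‖ ^ 2`; the squared norms sum to the trace of `ρ`. -/
theorem norm_trace_mul_le {n : ℕ} {ρ : QubitOp n} (hρ : ρ.PosSemidef) (htr : ρ.trace = 1)
    (X : QubitOp n) : ‖(ρ * X).trace‖ ≤ ‖X‖ := by
  classical
  obtain ⟨k, v, hv⟩ := Matrix.posSemidef_iff_eq_sum_vecMulVec.1 hρ
  have hsum : ∑ i, ‖WithLp.toLp 2 (v i)‖ ^ 2 = 1 := by
    have h : ((∑ i, ‖WithLp.toLp 2 (v i)‖ ^ 2 : ℝ) : ℂ) = 1 := by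
      rw [← htr, hv, Matrix.trace_sum]
      push_cast
      refine Finset.sum_congr rfl fun i _ => ?_
      rw [Matrix.trace_vecMulVec, ← Complex.coe_algebraMap, ← map_pow]
      rw [Complex.coe_algebraMap, Complex.ofReal_pow]
      have := inner_self_eq_norm_sq_to_K (𝕜 := ℂ) (WithLp.toLp 2 (v i))
      rw [EuclideanSpace.inner_eq_star_dotProduct] at this
      exact this.symm
    exact_mod_cast h
  have hterm : ∀ i, ‖(Matrix.vecMulVec (v i) (star (v i)) * X).trace‖ ≤
      ‖X‖ * ‖WithLp.toLp 2 (v i)‖ ^ 2 := by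
    intro i
    rw [Matrix.trace_mul_comm, Matrix.mul_vecMulVec, Matrix.trace_vecMulVec]
    have h1 : (X.mulVec (v i)) ⬝ᵥ star (v i) =
        inner ℂ (WithLp.toLp 2 (v i)) (Matrix.toEuclideanCLM (𝕜 := ℂ) X (WithLp.toLp 2 (v i))) := by
      rw [EuclideanSpace.inner_eq_star_dotProduct]
      rfl
    rw [h1, pow_two, ← mul_assoc, mul_comm (‖X‖ * _)]
    exact (norm_inner_le_norm _ _).trans
      (mul_le_mul_of_nonneg_left (ContinuousLinearMap.le_opNorm _ _) (norm_nonneg _))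
  calc ‖(ρ * X).trace‖ = ‖∑ i, (Matrix.vecMulVec (v i) (star (v i)) * X).trace‖ := by
        rw [hv, Finset.sum_mul, Matrix.trace_sum]
    _ ≤ ∑ i, ‖X‖ * ‖WithLp.toLp 2 (v i)‖ ^ 2 :=
        (norm_sum_le _ _).trans (Finset.sum_le_sum fun i _ => hterm i)
    _ = ‖X‖ := by rw [← Finset.mul_sum, hsum, mul_one]

theorem norm_sub_smul_one {n : ℕ} {H : QubitOp n} (hH : H.IsHermitian) (μ : ℝ) :
    ‖H - (μ : ℂ) • (1 : QubitOp n)‖ = ‖fun i => ((hH.eigenvalues i - μ : ℝ) : ℂ)‖ := by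
  have h1 : (Unitary.conjStarAlgAut ℂ (QubitOp n) hH.eigenvectorUnitary)
      (Matrix.diagonal fun i => ((hH.eigenvalues i - μ : ℝ) : ℂ)) =
      H - (μ : ℂ) • (1 : QubitOp n) := by
    have h2 : (Matrix.diagonal fun i => ((hH.eigenvalues i - μ : ℝ) : ℂ)) =
        Matrix.diagonal (RCLike.ofReal ∘ hH.eigenvalues) - (μ : ℂ) • (1 : QubitOp n) := by
      rw [Matrix.smul_one_eq_diagonal, Matrix.diagonal_sub]
      congr 1
      ext i
      simp
    rw [h2, map_sub, ← hH.spectral_theorem, map_smul, map_one]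
  rw [← h1, Unitary.conjStarAlgAut_apply, CStarRing.norm_mul_mem_unitary,
    CStarRing.norm_coe_unitary_mul, Matrix.l2_opNorm_diagonal]
  exact Unitary.star_mem (SetLike.coe_mem _)

theorem maxFreq_nonneg {n : ℕ} {H : QubitOp n} (hH : H.IsHermitian) : 0 ≤ H.maxFreq hH :=
  sub_nonneg.2 ((ciInf_le (Set.finite_range _).bddBelow (0 : Fin n → Fin 2)).trans
    (le_ciSup (Set.finite_range _).bddAbove _))

theorem maxFreq_le {n : ℕ} {H : QubitOp n} (hH : H.IsHermitian) :
    H.maxFreq hH ≤ 2 * H.opNorm := by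
  have h : ∀ i, |hH.eigenvalues i| ≤ ‖H‖ := fun i => by
    have h0 := norm_sub_smul_one hH 0
    simp only [Complex.ofReal_zero, zero_smul, sub_zero] at h0
    rw [h0]
    have := norm_le_pi_norm (fun i => ((hH.eigenvalues i : ℝ) : ℂ)) i
    simpa using this
  have h1 : (⨆ i, hH.eigenvalues i) ≤ ‖H‖ := ciSup_le fun i => (abs_le.1 (h i)).2
  have h2 : -‖H‖ ≤ ⨅ i, hH.eigenvalues i := le_ciInf fun i => (abs_le.1 (h i)).1
  rw [maxFreq, opNorm_eq_norm]
  linarith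

/-- Shifting a Hermitian operator by the midpoint of its spectrum. -/
theorem exists_norm_sub_smul_one_le {n : ℕ} {H : QubitOp n} (hH : H.IsHermitian) :
    ∃ μ : ℝ, ‖H - (μ : ℂ) • (1 : QubitOp n)‖ ≤ H.maxFreq hH / 2 := by
  refine ⟨((⨆ i, hH.eigenvalues i) + ⨅ i, hH.eigenvalues i) / 2, ?_⟩
  rw [norm_sub_smul_one hH, pi_norm_le_iff_of_nonneg (div_nonneg (maxFreq_nonneg hH) two_pos.le)]
  intro i
  rw [Complex.norm_real, Real.norm_eq_abs, maxFreq, abs_le]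
  have h1 := ciInf_le (Set.finite_range hH.eigenvalues).bddBelow i
  have h2 := le_ciSup (Set.finite_range hH.eigenvalues).bddAbove i
  constructor <;> linarith

end QubitOp

namespace QuantumLoss

variable {n m M : ℕ}

/-- Up to a phase, each rotation is generated by an operator of norm `maxFreq / 2`. -/
theorem exists_gate_eq (Q : QuantumLoss n m M) (l : Fin M) :
    ∃ B : QubitOp n, ‖B‖ ≤ (Q.H l).maxFreq (Q.H_hermitian l) / 2 ∧
      (∀ t : ℝ, ‖NormedSpace.exp (t • B)‖ ≤ 1) ∧
      ∀ t : ℝ, ∃ c : ℂ, ‖c‖ = 1 ∧ Q.gate l t = c • NormedSpace.exp (t • B) := by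
  let : NormedAlgebra ℚ (QubitOp n) := NormedAlgebra.restrictScalars ℚ ℝ (QubitOp n)
  obtain ⟨μ, hμ⟩ := QubitOp.exists_norm_sub_smul_one_le (Q.H_hermitian l)
  refine ⟨-Complex.I • (Q.H l - (μ : ℂ) • (1 : QubitOp n)), ?_, fun t => ?_, fun t => ?_⟩
  · simpa [norm_smul] using hμ
  · refine (CStarRing.norm_of_mem_unitary
      (NormedSpace.exp_mem_unitary_of_mem_skewAdjoint ?_)).le
    rw [skewAdjoint.mem_iff, star_smul, star_smul, star_sub, star_smul, star_one,
      Matrix.star_eq_conjTranspose, (Q.H_hermitian l).eq]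
    simp
  -- The subtracted scalar commutes with everything, so its exponential splits off as a phase.
  · refine ⟨Complex.exp (-Complex.I * t * μ), ?_, ?_⟩
    · rw [Complex.norm_exp]
      simp
    · have h : (-Complex.I * (t : ℂ)) • Q.H l = (-Complex.I * t * μ) • (1 : QubitOp n) +
          t • (-Complex.I • (Q.H l - (μ : ℂ) • (1 : QubitOp n))) := by
        rw [← Complex.coe_smul t, smul_smul, smul_sub, smul_smul,
          mul_comm (t : ℂ) (-Complex.I)]
        abel
      rw [gate, h, NormedSpace.exp_add_of_commute
        ((Commute.one_left _).smul_left _)]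
      rw [← Algebra.algebraMap_eq_smul_one, ← NormedSpace.algebraMap_exp_comm,
        ← Complex.exp_eq_exp_ℂ, Algebra.algebraMap_eq_smul_one, smul_one_mul]

theorem omega_nonneg (Q : QuantumLoss n m M) (q : Fin m) : 0 ≤ Q.omega q :=
  Finset.sum_nonneg fun _ _ => QubitOp.maxFreq_nonneg _

/-- Up to a phase, the circuit has partial derivatives controlled by `omega / 2`. -/
theorem exists_circuit_eq (Q : QuantumLoss n m M) (k : ℕ) :
    ∃ U : (Fin m → ℝ) → QubitOp n, PartialsBounded (fun q => Q.omega q / 2) k 1 U ∧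
      ∀ θ, ∃ c : ℂ, ‖c‖ = 1 ∧ Q.circuit θ = c • U θ := by
  choose B hB hexp hgate using Q.exists_gate_eq
  refine ⟨fun θ => ((List.finRange M).map fun l =>
    Q.V l * NormedSpace.exp (θ (Q.S l) • B l)).prod, ?_, fun θ => ?_⟩
  · have hfac : ∀ l, PartialsBounded
        (Pi.single (Q.S l) ((Q.H l).maxFreq (Q.H_hermitian l) / 2)) k 1
        (fun θ : Fin m → ℝ => Q.V l * NormedSpace.exp (θ (Q.S l) • B l)) := fun l => by
      have h1 := PartialsBounded.const (0 : Fin m → ℝ) (fun _ => le_rfl) k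
        (CStarRing.norm_of_mem_unitary (Q.V_unitary l)).le
      simpa using h1.mul (PartialsBounded.exp_smul (Q.S l) (B l) (hB l) (hexp l) k)
    have h := PartialsBounded.list_prod hfac (List.finRange M)
    have hw : ((List.finRange M).map fun l =>
        (Pi.single (Q.S l) ((Q.H l).maxFreq (Q.H_hermitian l) / 2) : Fin m → ℝ)).sum =
        fun q => Q.omega q / 2 := by
      rw [← List.ofFn_eq_map, List.sum_ofFn]
      ext q
      rw [omega, Finset.sum_apply, Finset.sum_div, Finset.sum_filter]
      refine Finset.sum_congr rfl fun l _ => ?_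
      rw [Pi.single_apply]
      simp only [eq_comm]
    rw [hw] at h
    exact h
  · rw [circuit, List.ofFn_eq_map]
    beta_reduce
    generalize List.finRange M = L
    induction L with
    | nil => exact ⟨1, by simp, by simp⟩
    | cons l L ih =>
      obtain ⟨c, hc, hc'⟩ := ih
      obtain ⟨d, hd, hd'⟩ := hgate l (θ (Q.S l))
      refine ⟨d * c, by rw [norm_mul, hd, hc, one_mul], ?_⟩
      rw [List.map_cons, List.prod_cons, hc', hd', List.map_cons, List.prod_cons,
        mul_smul_comm, mul_smul_comm, smul_mul_assoc, smul_smul, mul_comm c d]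

/-- In the Heisenberg picture the loss is `Tr[ρ U† O U]`. The phase of `U` cancels, and the weights
`ω / 2` of `U†` and of `U` add up to `ω`. -/
theorem loss_partialsBounded (Q : QuantumLoss n m M) (k : ℕ) :
    PartialsBounded Q.omega k Q.O.opNorm Q.loss := by
  obtain ⟨U, hU, hc⟩ := Q.exists_circuit_eq k
  have hstar : PartialsBounded (fun q => Q.omega q / 2) k 1 (fun θ => star (U θ)) := by
    simpa using hU.clm_comp ((starL' ℝ : QubitOp n ≃L[ℝ] QubitOp n) : QubitOp n →L[ℝ] QubitOp n)
      (c := 1) (fun a => by simp) zero_le_one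
  have hO := PartialsBounded.const (0 : Fin m → ℝ) (fun _ => le_rfl) k
    (le_refl ‖Q.O‖)
  have hX := (hstar.mul hO).mul hU
  let T : QubitOp n →ₗ[ℝ] ℝ :=
    { toFun := fun X => (Q.rho * X).trace.re
      map_add' := fun X Y => by rw [mul_add, Matrix.trace_add, Complex.add_re]
      map_smul' := fun t X => by
        rw [mul_smul_comm, Matrix.trace_smul, Complex.smul_re, RingHom.id_apply] }
  have hT : ∀ X, ‖T X‖ ≤ 1 * ‖X‖ := fun X => by
    rw [one_mul]
    exact (Complex.abs_re_le_norm _).trans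
      (QubitOp.norm_trace_mul_le Q.rho_posSemidef Q.rho_trace X)
  have h := hX.clm_comp (T.mkContinuous 1 hT) hT zero_le_one
  have hw : (fun q => Q.omega q / 2) + 0 + (fun q => Q.omega q / 2) = Q.omega := by
    ext q
    simp
  rw [hw, one_mul, one_mul, mul_one] at h
  refine (congrArg (PartialsBounded Q.omega k Q.O.opNorm) (funext fun θ => ?_)).mpr h
  obtain ⟨c, hc, hc'⟩ := hc θ
  have hcc : star c * c = 1 := by
    rw [mul_comm]
    change c * (starRingEnd ℂ) c = 1
    rw [Complex.mul_conj, Complex.normSq_eq_norm_sq, hc]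
    simp
  change (Q.circuit θ * Q.rho * (Q.circuit θ).conjTranspose * Q.O).trace.re =
    (Q.rho * (star (U θ) * Q.O * U θ)).trace.re
  rw [hc', Matrix.conjTranspose_smul, ← Matrix.star_eq_conjTranspose]
  simp only [smul_mul_assoc, mul_smul_comm, smul_smul, hcc, one_smul]
  rw [mul_assoc, mul_assoc, Matrix.trace_mul_comm]
  simp only [mul_assoc]

end QuantumLoss

end Operators

/-! ### Taylor estimates for symmetric averages. -/

section SymmetricTaylor

/-- This is the mean value inequality on the segment from `0` to `x`. The factor `1 / (k + 1)` that
integration would give is dropped; the constants of the final bound leave room for it. -/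
theorem abs_le_mul_pow_succ_of_hasDerivAt {e e' : ℝ → ℝ} {K : ℝ} {k : ℕ} (h0 : e 0 = 0)
    (hd : ∀ x, HasDerivAt e (e' x) x) (hK : 0 ≤ K) (hb : ∀ x, |e' x| ≤ K * |x| ^ k) (x : ℝ) :
    |e x| ≤ K * |x| ^ (k + 1) := by
  have h := Convex.norm_image_sub_le_of_norm_hasDerivWithin_le (f := e) (f' := e')
    (s := Set.uIcc 0 x) (x := 0) (y := x) (C := K * |x| ^ k)
    (fun y _ => (hd y).hasDerivWithinAt) (fun y hy => (hb y).trans ?_)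
    (convex_uIcc 0 x) Set.left_mem_uIcc Set.right_mem_uIcc
  · simpa [h0, pow_succ, mul_assoc] using h
  · have hy' : |y| ≤ |x| := by simpa using Set.abs_sub_left_of_mem_uIcc hy
    gcongr

theorem abs_symm_sub_le {u u₁ u₂ : ℝ → ℝ} {a K : ℝ} (h₁ : ∀ x, HasDerivAt u (u₁ x) x)
    (h₂ : ∀ x, HasDerivAt u₁ (u₂ x) x) (hK : ∀ x, |u₂ x| ≤ K) (s : ℝ) :
    |(u (a + s) + u (a - s)) / 2 - u a| ≤ K * s ^ 2 := by
  have hK0 : 0 ≤ K := (abs_nonneg _).trans (hK 0)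
  have hd : ∀ s, HasDerivAt (fun s => (u (a + s) + u (a - s)) / 2 - u a)
      ((u₁ (a + s) - u₁ (a - s)) / 2) s := fun s => by
    have := ((((h₁ (a + s)).comp_const_add a s).add ((h₁ (a - s)).comp_const_sub a s)).div_const
      2).sub_const (u a)
    simpa [sub_eq_add_neg] using this
  have hd' : ∀ s, HasDerivAt (fun s => (u₁ (a + s) - u₁ (a - s)) / 2)
      ((u₂ (a + s) + u₂ (a - s)) / 2) s := fun s => by
    have := (((h₂ (a + s)).comp_const_add a s).sub ((h₂ (a - s)).comp_const_sub a s)).div_const 2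
    simpa [sub_eq_add_neg] using this
  have hb : ∀ s, |(u₂ (a + s) + u₂ (a - s)) / 2| ≤ K * |s| ^ 0 := fun s => by
    have h1 := abs_le.1 (hK (a + s))
    have h2 := abs_le.1 (hK (a - s))
    rw [pow_zero, mul_one, abs_le]
    constructor <;> linarith
  have h := abs_le_mul_pow_succ_of_hasDerivAt (by simp) hd hK0
    (abs_le_mul_pow_succ_of_hasDerivAt (by simp) hd' hK0 hb) s
  simpa using h

/-- The error and its first derivative in `s` vanish at `0`, and its second derivative is the
symmetric error of `u₂`, already controlled by `abs_symm_sub_le`; integrate twice. -/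
theorem abs_symm_sub_quadratic_le {u u₁ u₂ u₃ u₄ : ℝ → ℝ} {a K : ℝ}
    (h₁ : ∀ x, HasDerivAt u (u₁ x) x) (h₂ : ∀ x, HasDerivAt u₁ (u₂ x) x)
    (h₃ : ∀ x, HasDerivAt u₂ (u₃ x) x) (h₄ : ∀ x, HasDerivAt u₃ (u₄ x) x)
    (hK : ∀ x, |u₄ x| ≤ K) (s : ℝ) :
    |(u (a + s) + u (a - s)) / 2 - u a - u₂ a * s ^ 2 / 2| ≤ K * s ^ 4 := by
  have hK0 : 0 ≤ K := (abs_nonneg _).trans (hK 0)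
  have hd : ∀ s, HasDerivAt (fun s => (u (a + s) + u (a - s)) / 2 - u a - u₂ a * s ^ 2 / 2)
      ((u₁ (a + s) - u₁ (a - s)) / 2 - u₂ a * s) s := fun s => by
    have := (((((h₁ (a + s)).comp_const_add a s).add
      ((h₁ (a - s)).comp_const_sub a s)).div_const 2).sub_const (u a)).sub
      ((((hasDerivAt_id s).pow 2).const_mul (u₂ a)).div_const 2)
    refine this.congr_deriv ?_
    simp
    ring
  have hd' : ∀ s, HasDerivAt (fun s => (u₁ (a + s) - u₁ (a - s)) / 2 - u₂ a * s)
      ((u₂ (a + s) + u₂ (a - s)) / 2 - u₂ a) s := fun s => by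
    have := ((((h₂ (a + s)).comp_const_add a s).sub
      ((h₂ (a - s)).comp_const_sub a s)).div_const 2).sub ((hasDerivAt_id s).const_mul (u₂ a))
    refine this.congr_deriv ?_
    simp
  have hb : ∀ s, |(u₂ (a + s) + u₂ (a - s)) / 2 - u₂ a| ≤ K * |s| ^ 2 := fun s => by
    rw [sq_abs]
    exact abs_symm_sub_le h₃ h₄ hK s
  have h := abs_le_mul_pow_succ_of_hasDerivAt (by simp) hd hK0
    (abs_le_mul_pow_succ_of_hasDerivAt (by simp) hd' hK0 hb) s
  rwa [show 2 + 1 + 1 = 4 from rfl, Even.pow_abs (by decide)] at h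

end SymmetricTaylor

/-! ### The uniform measure on a cube: moments, reflections, independence. -/

section UniformBox

open MeasureTheory ProbabilityTheory

/-- The uniform distribution on `[a - r, a + r]`. -/
noncomputable def uniformInterval (a r : ℝ) : Measure ℝ :=
  cond volume (Set.Icc (a - r) (a + r))

theorem volume_interval (a r : ℝ) :
    volume (Set.Icc (a - r) (a + r)) = ENNReal.ofReal (2 * r) := by
  rw [Real.volume_Icc]
  congr 1
  ring

theorem isProbabilityMeasure_uniformInterval (a : ℝ) {r : ℝ} (hr : 0 < r) :
    IsProbabilityMeasure (uniformInterval a r) := by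
  refine cond_isProbabilityMeasure_of_finite ?_ ?_ <;> rw [volume_interval]
  · simpa using hr
  · exact ENNReal.ofReal_ne_top

theorem measurePreserving_reflect_uniformInterval (a r : ℝ) :
    MeasurePreserving (fun t => 2 * a - t) (uniformInterval a r) (uniformInterval a r) := by
  have h := (Measure.measurePreserving_sub_left volume (2 * a)).restrict_preimage
    (measurableSet_Icc (a := a - r) (b := a + r))
  have hs : (fun t => 2 * a - t) ⁻¹' Set.Icc (a - r) (a + r) = Set.Icc (a - r) (a + r) := by
    ext t
    simp only [Set.mem_preimage, Set.mem_Icc]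
    constructor <;> rintro ⟨h1, h2⟩ <;> constructor <;> linarith
  rw [hs] at h
  exact h.smul_measure _

theorem integral_uniformInterval (a : ℝ) {r : ℝ} (hr : 0 < r) (F : ℝ → ℝ) :
    ∫ t, F (t - a) ∂uniformInterval a r = (2 * r)⁻¹ * ∫ t in (-r)..r, F t := by
  rw [uniformInterval, ProbabilityTheory.cond, integral_smul_measure, volume_interval,
    integral_Icc_eq_integral_Ioc, ← intervalIntegral.integral_of_le (by linarith),
    intervalIntegral.integral_comp_sub_right, ENNReal.toReal_inv,
    ENNReal.toReal_ofReal (by positivity), smul_eq_mul]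
  congr 2 <;> ring

variable {ι : Type*} [Fintype ι]

/-- The uniform distribution on the cube of half-width `r` around `φ`. -/
noncomputable def uniformBox (φ : ι → ℝ) (r : ℝ) : Measure (ι → ℝ) :=
  cond volume (Set.Icc (fun i => φ i - r) (fun i => φ i + r))

theorem uniformBox_eq_pi (φ : ι → ℝ) {r : ℝ} (hr : 0 < r) :
    uniformBox φ r = Measure.pi fun i => uniformInterval (φ i) r := by
  have := fun i => isProbabilityMeasure_uniformInterval (φ i) hr
  refine (Measure.pi_eq fun s _ => ?_).symm
  rw [uniformBox, cond_apply measurableSet_Icc, ← Set.pi_univ_Icc, ← Set.pi_inter_distrib,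
    volume_pi_pi, volume_pi_pi]
  simp only [uniformInterval, cond_apply measurableSet_Icc, volume_interval,
    Finset.prod_mul_distrib, Finset.prod_const, ENNReal.inv_pow]

theorem isProbabilityMeasure_uniformBox (φ : ι → ℝ) {r : ℝ} (hr : 0 < r) :
    IsProbabilityMeasure (uniformBox φ r) := by
  have := fun i => isProbabilityMeasure_uniformInterval (φ i) hr
  rw [uniformBox_eq_pi φ hr]
  infer_instance

theorem Continuous.integrable_uniformBox {F : (ι → ℝ) → ℝ} (hF : Continuous F) (φ : ι → ℝ)
    {r : ℝ} (hr : 0 < r) : Integrable F (uniformBox φ r) := by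
  refine (hF.continuousOn.integrableOn_compact isCompact_Icc).smul_measure ?_
  rw [ENNReal.inv_ne_top, ← Set.pi_univ_Icc, volume_pi_pi]
  simp only [volume_interval]
  simpa [Finset.prod_const] using fun h : r ≤ 0 => absurd h hr.not_ge

theorem ae_uniformBox_abs_sub_le (φ : ι → ℝ) (r : ℝ) :
    ∀ᵐ y ∂uniformBox φ r, ∀ i, |y i - φ i| ≤ r := by
  have h : ∀ᵐ y ∂uniformBox φ r, y ∈ Set.Icc (fun i => φ i - r) (fun i => φ i + r) :=
    ae_cond_mem measurableSet_Icc
  filter_upwards [h] with y hy i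
  rw [abs_le]
  have h1 : φ i - r ≤ y i := hy.1 i
  have h2 : y i ≤ φ i + r := hy.2 i
  constructor <;> linarith

theorem integral_uniformBox_eval (φ : ι → ℝ) {r : ℝ} (hr : 0 < r) (p : ι) {F : ℝ → ℝ}
    (hF : Continuous F) :
    ∫ y, F (y p - φ p) ∂uniformBox φ r = (2 * r)⁻¹ * ∫ t in (-r)..r, F t := by
  have := fun i => isProbabilityMeasure_uniformInterval (φ i) hr
  rw [uniformBox_eq_pi φ hr, ← integral_uniformInterval (φ p) hr]
  have h := measurePreserving_eval (fun i => uniformInterval (φ i) r) p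
  conv_rhs => rw [← h.map_eq]
  rw [integral_map h.aemeasurable (by fun_prop)]

theorem integral_uniformBox_quadratic (φ : ι → ℝ) {r : ℝ} (hr : 0 < r) (p : ι) :
    ∫ y, ((y p - φ p) ^ 2 - r ^ 2 / 3) ∂uniformBox φ r = 0 := by
  rw [integral_uniformBox_eval φ hr p (F := fun t => t ^ 2 - r ^ 2 / 3) (by fun_prop),
    intervalIntegral.integral_sub (Continuous.intervalIntegrable (by fun_prop) _ _)
      (Continuous.intervalIntegrable (by fun_prop) _ _)]
  simp
  ring_nf
  simp

/-- This is Cauchy–Schwarz for the covariance of `f` with the centred quadratic, obtained by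
expanding the nonnegative integral of `((f - m) - c * P) ^ 2`. -/
theorem sq_integral_mul_quadratic_le_variance {f : (ι → ℝ) → ℝ} (hf : Continuous f) (φ : ι → ℝ)
    {r : ℝ} (hr : 0 < r) (p : ι) :
    (∫ y, f y * ((y p - φ p) ^ 2 - r ^ 2 / 3) ∂uniformBox φ r) ^ 2 ≤
      4 * r ^ 4 / 45 * variance f (uniformBox φ r) := by
  have := isProbabilityMeasure_uniformBox φ hr
  set P : (ι → ℝ) → ℝ := fun y => (y p - φ p) ^ 2 - r ^ 2 / 3 with hPdef
  have hP : Continuous P := by fun_prop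
  set A := ∫ y, f y * P y ∂uniformBox φ r with hA
  set m := ∫ y, f y ∂uniformBox φ r with hm
  have hmom0 : ∫ y, P y ∂uniformBox φ r = 0 := integral_uniformBox_quadratic φ hr p
  have hmom2 : ∫ y, P y ^ 2 ∂uniformBox φ r = 4 * r ^ 4 / 45 := by
    rw [hPdef, integral_uniformBox_eval φ hr p (F := fun t => (t ^ 2 - r ^ 2 / 3) ^ 2)
      (by fun_prop)]
    have : (fun t : ℝ => (t ^ 2 - r ^ 2 / 3) ^ 2) =
        fun t => t ^ 4 - 2 / 3 * r ^ 2 * t ^ 2 + r ^ 4 / 9 := by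
      ext t; ring
    rw [this, intervalIntegral.integral_add
        (Continuous.intervalIntegrable (by fun_prop) _ _)
        (Continuous.intervalIntegrable (by fun_prop) _ _),
      intervalIntegral.integral_sub
        (Continuous.intervalIntegrable (by fun_prop) _ _)
        (Continuous.intervalIntegrable (by fun_prop) _ _)]
    simp
    field_simp
    ring
  have hvar : variance f (uniformBox φ r) = ∫ y, (f y - m) ^ 2 ∂uniformBox φ r :=
    variance_eq_integral hf.aemeasurable
  have hexp : ∀ c : ℝ, ∫ y, ((f y - m) - c * P y) ^ 2 ∂uniformBox φ r =
      variance f (uniformBox φ r) - 2 * c * A + c ^ 2 * (4 * r ^ 4 / 45) := by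
    intro c
    have hsplit : (fun y => ((f y - m) - c * P y) ^ 2) = fun y =>
        (f y - m) ^ 2 - 2 * c * (f y * P y) + 2 * c * m * P y + c ^ 2 * P y ^ 2 := by
      ext y; ring
    have i1 : Integrable (fun y => (f y - m) ^ 2) (uniformBox φ r) :=
      Continuous.integrable_uniformBox (by fun_prop) φ hr
    have i2 : Integrable (fun y => 2 * c * (f y * P y)) (uniformBox φ r) :=
      Continuous.integrable_uniformBox (by fun_prop) φ hr
    have i3 : Integrable (fun y => 2 * c * m * P y) (uniformBox φ r) :=
      Continuous.integrable_uniformBox (by fun_prop) φ hr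
    have i4 : Integrable (fun y => c ^ 2 * P y ^ 2) (uniformBox φ r) :=
      Continuous.integrable_uniformBox (by fun_prop) φ hr
    have i12 : Integrable (fun y => (f y - m) ^ 2 - 2 * c * (f y * P y)) (uniformBox φ r) :=
      i1.sub i2
    have i123 : Integrable (fun y => (f y - m) ^ 2 - 2 * c * (f y * P y) + 2 * c * m * P y)
      (uniformBox φ r) := i12.add i3
    rw [hsplit, integral_add i123 i4, integral_add i12 i3,
      integral_sub i1 i2, integral_const_mul, integral_const_mul, integral_const_mul, hmom0, hmom2,
      ← hvar]
    ring
  have hv : 0 < 4 * r ^ 4 / 45 := by positivity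
  -- This `c` is the regression coefficient, which minimises the expanded quadratic.
  have h := hexp (A / (4 * r ^ 4 / 45))
  have hnn : 0 ≤ ∫ y, ((f y - m) - A / (4 * r ^ 4 / 45) * P y) ^ 2 ∂uniformBox φ r :=
    integral_nonneg fun y => sq_nonneg _
  rw [h] at hnn
  generalize 4 * r ^ 4 / 45 = v at hv hnn ⊢
  have h2 : variance f (uniformBox φ r) - 2 * (A / v) * A + (A / v) ^ 2 * v =
      variance f (uniformBox φ r) - A ^ 2 / v := by
    field_simp
    ring
  rw [h2, sub_nonneg, div_le_iff₀ hv] at hnn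
  linarith

variable [DecidableEq ι]

theorem integral_uniformBox_reflect (φ : ι → ℝ) {r : ℝ} (hr : 0 < r) (q : ι)
    {F : (ι → ℝ) → ℝ} (hF : Continuous F) :
    ∫ y, F (update y q (2 * φ q - y q)) ∂uniformBox φ r = ∫ y, F y ∂uniformBox φ r := by
  have := fun i => isProbabilityMeasure_uniformInterval (φ i) hr
  have h : MeasurePreserving (fun y : ι → ℝ => update y q (2 * φ q - y q))
      (uniformBox φ r) (uniformBox φ r) := by
    rw [uniformBox_eq_pi φ hr]
    have h := measurePreserving_pi (fun i => uniformInterval (φ i) r)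
      (fun i => uniformInterval (φ i) r)
      (f := fun i => if i = q then fun t => 2 * φ i - t else id) fun i => by
        split_ifs
        · exact measurePreserving_reflect_uniformInterval _ _
        · exact MeasurePreserving.id _
    convert h using 1
    ext y i
    by_cases hi : i = q
    · subst hi; simp
    · simp [hi]
  conv_rhs => rw [← h.map_eq]
  rw [integral_map h.aemeasurable hF.aestronglyMeasurable]

theorem integral_uniformBox_symm (φ : ι → ℝ) {r : ℝ} (hr : 0 < r) (q : ι)
    {F : (ι → ℝ) → ℝ} (hF : Continuous F) :
    ∫ y, F y ∂uniformBox φ r =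
      ∫ y, (F y + F (update y q (2 * φ q - y q))) / 2 ∂uniformBox φ r := by
  have hF' : Continuous fun y => F (update y q (2 * φ q - y q)) := hF.comp (by fun_prop)
  rw [integral_div, integral_add (hF.integrable_uniformBox φ hr)
    (hF'.integrable_uniformBox φ hr), integral_uniformBox_reflect φ hr q hF]
  ring

/-- With coordinate `p` frozen, the first factor depends only on the other coordinates, which are
independent of `y p` under the product measure. -/
theorem integral_uniformBox_mul (φ : ι → ℝ) {r : ℝ} (hr : 0 < r) (p : ι)
    {F : (ι → ℝ) → ℝ} (hF : Continuous F) {G : ℝ → ℝ} (hG : Continuous G) :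
    ∫ y, F (update y p (φ p)) * G (y p) ∂uniformBox φ r =
      (∫ y, F (update y p (φ p)) ∂uniformBox φ r) * ∫ y, G (y p) ∂uniformBox φ r := by
  have := fun i => isProbabilityMeasure_uniformInterval (φ i) hr
  have hind : iIndepFun (fun i (y : ι → ℝ) => y i) (uniformBox φ r) := by
    rw [uniformBox_eq_pi φ hr]
    exact iIndepFun_pi (X := fun _ t => t) fun i => aemeasurable_id
  have h := hind.indepFun_finset (Finset.univ.erase p) {p} (by simp)
    fun i => measurable_pi_apply i
  -- `E` rebuilds a full point from the coordinates other than `p`, exhibiting the first factor as a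
  -- function of those alone.
  let E : (↥(Finset.univ.erase p) → ℝ) → ι → ℝ := fun z i =>
    if hi : i ∈ Finset.univ.erase p then z ⟨i, hi⟩ else φ p
  have hE : Continuous E := by
    refine continuous_pi fun i => ?_
    by_cases hi : i ∈ Finset.univ.erase p
    · simp only [E, hi, dif_pos]
      exact continuous_apply _
    · simp only [E, hi, dif_neg, not_false_eq_true]
      exact continuous_const
  have hGp : Continuous fun z : ↥({p} : Finset ι) → ℝ => G (z ⟨p, Finset.mem_singleton_self p⟩) :=
    hG.comp (continuous_apply _)
  have h' := h.comp (hF.comp hE).measurable hGp.measurable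
  have hEy : ∀ y : ι → ℝ, E (fun i => y i) = update y p (φ p) := fun y => by
    ext i
    by_cases hi : i = p
    · subst hi; simp [E]
    · simp [E, hi]
  have key := h'.integral_fun_mul_eq_mul_integral
    ((hF.comp hE).comp (by fun_prop)).aestronglyMeasurable
    (hGp.comp (by fun_prop)).aestronglyMeasurable
  simpa only [comp_apply, hEy] using key

end UniformBox

/-! ### Variance lower bound from derivative bounds. -/

section BoxVariance

open MeasureTheory ProbabilityTheory

variable {ι : Type*} [Fintype ι] [DecidableEq ι]

/-- Coordinates are released from `φ` one at a time. Averaging over the reflection in the released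
coordinate `q` removes the linear term, so each release costs only `C * w q ^ 2 * r ^ 2` and no
mixed derivatives enter. -/
theorem PartialsBounded.abs_integral_piecewise_sub_le {w : ι → ℝ} {C : ℝ} {h : (ι → ℝ) → ℝ}
    (hh : PartialsBounded w 2 C h) (φ : ι → ℝ) {r : ℝ} (hr : 0 < r)
    (T : Finset ι) :
    |∫ y, h (T.piecewise y φ) ∂uniformBox φ r - h φ| ≤ C * (∑ q ∈ T, w q ^ 2) * r ^ 2 := by
  have := isProbabilityMeasure_uniformBox φ hr
  have hcont : ∀ T : Finset ι, Continuous fun y => h (T.piecewise y φ) := fun T =>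
    hh.continuous.comp (continuous_pi fun i => by
      by_cases hi : i ∈ T
      · simpa [Finset.piecewise, hi] using continuous_apply i
      · simpa [Finset.piecewise, hi] using continuous_const)
  induction T using Finset.induction_on with
  | empty => simp
  | insert q T hq ih =>
    obtain ⟨h₁, hd₁, hb₁⟩ := hh.2 q
    obtain ⟨h₂, hd₂, hb₂⟩ := hb₁.2 q
    have hpt : ∀ y : ι → ℝ, |y q - φ q| ≤ r →
        |(h ((insert q T).piecewise y φ) +
          h ((insert q T).piecewise (update y q (2 * φ q - y q)) φ)) / 2 -
            h (T.piecewise y φ)| ≤ C * w q ^ 2 * r ^ 2 := by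
      intro y hy
      set z := T.piecewise y φ with hz
      have hzq : z q = φ q := by simp [hz, hq]
      have hz' : T.piecewise (update y q (2 * φ q - y q)) φ = z := by
        rw [hz]
        ext i
        by_cases hi : i ∈ T
        · have : i ≠ q := fun h => hq (h ▸ hi)
          simp [hi, this]
        · simp [hi]
      have e := abs_symm_sub_le (u := fun t => h (update z q t)) (u₁ := fun t => h₁ (update z q t))
        (u₂ := fun t => h₂ (update z q t)) (a := φ q) (K := C * w q * w q)
        (fun t => by simpa using hd₁ (update z q t)) (fun t => by simpa using hd₂ (update z q t))
        (fun t => hb₂.norm_le _) (y q - φ q)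
      rw [Finset.piecewise_insert, Finset.piecewise_insert, hz', ← hz, update_self]
      have e1 : φ q + (y q - φ q) = y q := by ring
      have e2 : φ q - (y q - φ q) = 2 * φ q - y q := by ring
      have e3 : update z q (φ q) = z := by rw [← hzq, update_eq_self]
      simp only [e1, e2, e3] at e
      refine e.trans ?_
      have : (y q - φ q) ^ 2 ≤ r ^ 2 := by
        rw [← sq_abs]
        gcongr
      have hC := hb₂.nonneg
      nlinarith
    have hstep : |∫ y, h ((insert q T).piecewise y φ) ∂uniformBox φ r -
        ∫ y, h (T.piecewise y φ) ∂uniformBox φ r| ≤ C * w q ^ 2 * r ^ 2 := by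
      have hc := hcont (insert q T)
      have hc' : Continuous fun y : ι → ℝ =>
          h ((insert q T).piecewise (update y q (2 * φ q - y q)) φ) :=
        hc.comp (by fun_prop)
      have i1 : Integrable (fun y => (h ((insert q T).piecewise y φ) +
          h ((insert q T).piecewise (update y q (2 * φ q - y q)) φ)) / 2) (uniformBox φ r) :=
        ((hc.add hc').div_const 2).integrable_uniformBox φ hr
      rw [integral_uniformBox_symm φ hr q hc, ← integral_sub i1
        ((hcont T).integrable_uniformBox φ hr)]
      have := norm_integral_le_of_norm_le_const (μ := uniformBox φ r)
        (f := fun y => (h ((insert q T).piecewise y φ) +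
          h ((insert q T).piecewise (update y q (2 * φ q - y q)) φ)) / 2 - h (T.piecewise y φ))
        (C := C * w q ^ 2 * r ^ 2) ((ae_uniformBox_abs_sub_le φ r).mono fun y hy => hpt y (hy q))
      simpa using this
    rw [Finset.sum_insert hq]
    have := abs_sub_le (∫ y, h ((insert q T).piecewise y φ) ∂uniformBox φ r)
      (∫ y, h (T.piecewise y φ) ∂uniformBox φ r) (h φ)
    linarith

/-- The component of the loss along the centred quadratic polynomial in one coordinate. -/
theorem PartialsBounded.exists_abs_integral_mul_quadratic_sub_le {w : ι → ℝ} {C : ℝ}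
    {f : (ι → ℝ) → ℝ} (hf : PartialsBounded w 4 C f) (φ : ι → ℝ) {r : ℝ}
    (hr : 0 < r) (p : ι) :
    ∃ d : ℝ, |d| ≤ C * w p ^ 2 ∧
      |d - iteratedDeriv 2 (fun t => f (update φ p t)) (φ p)| ≤
        C * w p ^ 2 * (∑ q ∈ Finset.univ.erase p, w q ^ 2) * r ^ 2 ∧
      |∫ y, f y * ((y p - φ p) ^ 2 - r ^ 2 / 3) ∂uniformBox φ r - 2 * r ^ 4 / 45 * d| ≤
        2 / 15 * (C * w p ^ 4) * r ^ 6 := by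
  have := isProbabilityMeasure_uniformBox φ hr
  obtain ⟨f₁, hd₁, hb₁⟩ := hf.2 p
  obtain ⟨f₂, hd₂, hb₂⟩ := hb₁.2 p
  obtain ⟨f₃, hd₃, hb₃⟩ := hb₂.2 p
  obtain ⟨f₄, hd₄, hb₄⟩ := hb₃.2 p
  have hD₁ : ∀ y t, HasDerivAt (fun t => f (update y p t)) (f₁ (update y p t)) t :=
    fun y t => by simpa using hd₁ (update y p t)
  have hD₂ : ∀ y t, HasDerivAt (fun t => f₁ (update y p t)) (f₂ (update y p t)) t :=
    fun y t => by simpa using hd₂ (update y p t)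
  have hD₃ : ∀ y t, HasDerivAt (fun t => f₂ (update y p t)) (f₃ (update y p t)) t :=
    fun y t => by simpa using hd₃ (update y p t)
  have hD₄ : ∀ y t, HasDerivAt (fun t => f₃ (update y p t)) (f₄ (update y p t)) t :=
    fun y t => by simpa using hd₄ (update y p t)
  have hcurv : iteratedDeriv 2 (fun t => f (update φ p t)) (φ p) = f₂ φ := by
    have h1 : deriv (fun t => f (update φ p t)) = fun t => f₁ (update φ p t) :=
      funext fun t => (hD₁ φ t).deriv
    rw [iteratedDeriv_succ, iteratedDeriv_one, h1, (hD₂ φ _).deriv, update_eq_self]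
  have hpw : ∀ y : ι → ℝ, (Finset.univ.erase p).piecewise y φ = update y p (φ p) := fun y => by
    ext i
    by_cases hi : i = p
    · subst hi; simp
    · simp [hi]
  have hfc := hf.continuous
  have hf₂c := hb₂.continuous
  have hP : Continuous fun y : ι → ℝ => (y p - φ p) ^ 2 - r ^ 2 / 3 := by fun_prop
  have hup : Continuous fun y : ι → ℝ => update y p (φ p) := by fun_prop
  -- Take `d` to be the second derivative in direction `p`, averaged over the other coordinates with
  -- `y p` frozen at `φ p`.
  refine ⟨∫ y, f₂ (update y p (φ p)) ∂uniformBox φ r, ?_, ?_, ?_⟩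
  · have := norm_integral_le_of_norm_le_const (μ := uniformBox φ r)
      (Filter.Eventually.of_forall fun y => hb₂.norm_le (update y p (φ p)))
    simpa [pow_two, mul_assoc] using this
  · have := hb₂.abs_integral_piecewise_sub_le φ hr (Finset.univ.erase p)
    simp only [hpw] at this
    rw [hcurv]
    simpa [pow_two, mul_assoc] using this
  · have hK : 0 ≤ C * w p ^ 4 := mul_nonneg hf.nonneg (by positivity)
    have hsymm := integral_uniformBox_symm φ hr p
      (F := fun y => f y * ((y p - φ p) ^ 2 - r ^ 2 / 3)) (by fun_prop)
    have hmom0 := integral_uniformBox_quadratic φ hr p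
    have hmom2 : ∫ y, ((y p - φ p) ^ 2 / 2 * ((y p - φ p) ^ 2 - r ^ 2 / 3)) ∂uniformBox φ r =
        2 * r ^ 4 / 45 := by
      rw [integral_uniformBox_eval φ hr p (F := fun t => t ^ 2 / 2 * (t ^ 2 - r ^ 2 / 3))
        (by fun_prop)]
      have : (fun t : ℝ => t ^ 2 / 2 * (t ^ 2 - r ^ 2 / 3)) =
          fun t => t ^ 4 / 2 - r ^ 2 / 6 * t ^ 2 := by
        ext t; ring
      rw [this, intervalIntegral.integral_sub
        (Continuous.intervalIntegrable (by fun_prop) _ _)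
        (Continuous.intervalIntegrable (by fun_prop) _ _)]
      simp
      field_simp
      ring
    have hmom4 : ∫ y, C * w p ^ 4 * (2 / 3 * r ^ 2) * (y p - φ p) ^ 4 ∂uniformBox φ r =
        2 / 15 * (C * w p ^ 4) * r ^ 6 := by
      rw [integral_const_mul, integral_uniformBox_eval φ hr p (F := fun t => t ^ 4) (by fun_prop)]
      simp
      field_simp
      ring
    -- The constant Taylor term does not involve `y p`, so it is orthogonal to the mean-zero
    -- quadratic.
    have hzero : ∫ y, f (update y p (φ p)) * ((y p - φ p) ^ 2 - r ^ 2 / 3) ∂uniformBox φ r = 0 := by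
      rw [integral_uniformBox_mul φ hr p hfc (G := fun t => (t - φ p) ^ 2 - r ^ 2 / 3)
        (by fun_prop), hmom0, mul_zero]
    have htwo : ∫ y, f₂ (update y p (φ p)) *
        ((y p - φ p) ^ 2 / 2 * ((y p - φ p) ^ 2 - r ^ 2 / 3)) ∂uniformBox φ r =
        2 * r ^ 4 / 45 * ∫ y, f₂ (update y p (φ p)) ∂uniformBox φ r := by
      rw [integral_uniformBox_mul φ hr p hf₂c
        (G := fun t => (t - φ p) ^ 2 / 2 * ((t - φ p) ^ 2 - r ^ 2 / 3)) (by fun_prop), hmom2,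
        mul_comm]
    have hrem : ∫ y, f y * ((y p - φ p) ^ 2 - r ^ 2 / 3) ∂uniformBox φ r -
        2 * r ^ 4 / 45 * ∫ y, f₂ (update y p (φ p)) ∂uniformBox φ r =
        ∫ y, ((f y * ((y p - φ p) ^ 2 - r ^ 2 / 3) + f (update y p (2 * φ p - y p)) *
          ((update y p (2 * φ p - y p) p - φ p) ^ 2 - r ^ 2 / 3)) / 2 -
          f (update y p (φ p)) * ((y p - φ p) ^ 2 - r ^ 2 / 3) -
          f₂ (update y p (φ p)) * ((y p - φ p) ^ 2 / 2 * ((y p - φ p) ^ 2 - r ^ 2 / 3)))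
          ∂uniformBox φ r := by
      have hrefl : Continuous fun y : ι → ℝ => update y p (2 * φ p - y p) := by fun_prop
      have i1 : Integrable (fun y => (f y * ((y p - φ p) ^ 2 - r ^ 2 / 3) +
          f (update y p (2 * φ p - y p)) *
            ((update y p (2 * φ p - y p) p - φ p) ^ 2 - r ^ 2 / 3)) / 2) (uniformBox φ r) :=
        Continuous.integrable_uniformBox (by simp only [update_self]; fun_prop) φ hr
      have i2 : Integrable (fun y => f (update y p (φ p)) * ((y p - φ p) ^ 2 - r ^ 2 / 3))
          (uniformBox φ r) := Continuous.integrable_uniformBox (by fun_prop) φ hr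
      have i3 : Integrable (fun y => f₂ (update y p (φ p)) *
          ((y p - φ p) ^ 2 / 2 * ((y p - φ p) ^ 2 - r ^ 2 / 3))) (uniformBox φ r) :=
        Continuous.integrable_uniformBox (by fun_prop) φ hr
      have i12 : Integrable (fun y => (f y * ((y p - φ p) ^ 2 - r ^ 2 / 3) +
          f (update y p (2 * φ p - y p)) *
            ((update y p (2 * φ p - y p) p - φ p) ^ 2 - r ^ 2 / 3)) / 2 -
          f (update y p (φ p)) * ((y p - φ p) ^ 2 - r ^ 2 / 3)) (uniformBox φ r) := i1.sub i2
      rw [integral_sub i12 i3, integral_sub i1 i2, hzero, htwo, hsymm, sub_zero]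
    -- The remainder is at most `C * w p ^ 4 * (y p - φ p) ^ 4` times the sup bound `2 / 3 * r ^ 2`
    -- of the quadratic; the fourth moment `r ^ 4 / 5` yields `2 / 15`.
    rw [hrem, ← hmom4, ← Real.norm_eq_abs]
    refine norm_integral_le_of_norm_le (Continuous.integrable_uniformBox (by fun_prop) φ hr)
      ((ae_uniformBox_abs_sub_le φ r).mono fun y hy => ?_)
    have hy2 : (y p - φ p) ^ 2 ≤ r ^ 2 := by
      rw [← sq_abs]
      gcongr
      exact hy p
    have e := abs_symm_sub_quadratic_le (a := φ p) (K := C * w p ^ 4) (hD₁ y) (hD₂ y) (hD₃ y)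
      (hD₄ y) (fun t => (hb₄.norm_le _).trans_eq (by ring)) (y p - φ p)
    have e1 : φ p + (y p - φ p) = y p := by ring
    have e2 : φ p - (y p - φ p) = 2 * φ p - y p := by ring
    rw [e1, e2, update_eq_self] at e
    have hfac : (f y * ((y p - φ p) ^ 2 - r ^ 2 / 3) + f (update y p (2 * φ p - y p)) *
          ((update y p (2 * φ p - y p) p - φ p) ^ 2 - r ^ 2 / 3)) / 2 -
          f (update y p (φ p)) * ((y p - φ p) ^ 2 - r ^ 2 / 3) -
          f₂ (update y p (φ p)) * ((y p - φ p) ^ 2 / 2 * ((y p - φ p) ^ 2 - r ^ 2 / 3)) =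
        ((f y + f (update y p (2 * φ p - y p))) / 2 - f (update y p (φ p)) -
          f₂ (update y p (φ p)) * (y p - φ p) ^ 2 / 2) * ((y p - φ p) ^ 2 - r ^ 2 / 3) := by
      rw [update_self]
      ring
    have hPle : |(y p - φ p) ^ 2 - r ^ 2 / 3| ≤ 2 / 3 * r ^ 2 := by
      rw [abs_le]
      constructor <;> nlinarith [sq_nonneg (y p - φ p)]
    rw [hfac, Real.norm_eq_abs, abs_mul]
    calc _ ≤ C * w p ^ 4 * (y p - φ p) ^ 4 * (2 / 3 * r ^ 2) :=
          mul_le_mul e hPle (abs_nonneg _) (by positivity)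
      _ = _ := by ring

theorem PartialsBounded.variance_uniformBox_ge {w : ι → ℝ} {C c : ℝ}
    {f : (ι → ℝ) → ℝ} (hf : PartialsBounded w 4 C f) (φ : ι → ℝ) {r : ℝ}
    (hr : 0 < r) (p : ι) (hc : c = |iteratedDeriv 2 (fun t => f (update φ p t)) (φ p)|)
    (hsmall : 8 / 3 * C * w p ^ 2 * (∑ q ∈ Finset.univ.erase p, w q ^ 2) * r ^ 2 ≤ c) :
    r ^ 4 / 45 * ((c - 8 / 3 * C * w p ^ 2 * (∑ q ∈ Finset.univ.erase p, w q ^ 2) * r ^ 2) ^ 2 -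
      32 / 3 * C ^ 2 * w p ^ 6 * r ^ 2) ≤ variance f (uniformBox φ r) := by
  obtain ⟨d, hd, hdc, hI⟩ := hf.exists_abs_integral_mul_quadratic_sub_le φ hr p
  have hvar := sq_integral_mul_quadratic_le_variance hf.continuous φ hr p
  have hC := hf.nonneg
  set S := ∑ q ∈ Finset.univ.erase p, w q ^ 2
  set I := ∫ y, f y * ((y p - φ p) ^ 2 - r ^ 2 / 3) ∂uniformBox φ r
  set V := variance f (uniformBox φ r)
  have hS : 0 ≤ S := Finset.sum_nonneg fun q _ => sq_nonneg _
  have hcd : c - 8 / 3 * C * w p ^ 2 * S * r ^ 2 ≤ |d| := by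
    have h1 : c ≤ |d| + C * w p ^ 2 * S * r ^ 2 := by
      rw [hc]
      have := abs_sub_abs_le_abs_sub (iteratedDeriv 2 (fun t => f (update φ p t)) (φ p)) d
      rw [abs_sub_comm] at this
      linarith
    -- The argument needs the coefficient `1` only; the stated `8 / 3` is weaker.
    have : 0 ≤ C * w p ^ 2 * S * r ^ 2 := by positivity
    linarith
  have hsq : (c - 8 / 3 * C * w p ^ 2 * S * r ^ 2) ^ 2 ≤ |d| ^ 2 :=
    pow_le_pow_left₀ (sub_nonneg.2 hsmall) hcd 2
  have hIlow : 2 * r ^ 4 / 45 * (|d| - 3 * (C * w p ^ 4) * r ^ 2) ≤ |I| := by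
    have := abs_sub_abs_le_abs_sub (2 * r ^ 4 / 45 * d) I
    rw [abs_sub_comm, abs_mul, abs_of_pos (by positivity : 0 < 2 * r ^ 4 / 45)] at this
    nlinarith
  have hdK : |d| * (C * w p ^ 4) ≤ C ^ 2 * w p ^ 6 :=
    (mul_le_mul_of_nonneg_right hd (by positivity)).trans_eq (by ring)
  have hV : 0 ≤ V := variance_nonneg _ _
  have hmain : r ^ 4 / 45 * (|d| ^ 2 - 6 * (|d| * (C * w p ^ 4)) * r ^ 2) ≤ V := by
    set K := C * w p ^ 4
    have hK : 0 ≤ K := by positivity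
    -- If the main term does not dominate the Taylor remainder, the claimed bound is nonpositive and
    -- holds trivially.
    rcases le_total (3 * K * r ^ 2) |d| with h | h
    · have h1 : (2 * r ^ 4 / 45 * (|d| - 3 * K * r ^ 2)) ^ 2 ≤ 4 * r ^ 4 / 45 * V := by
        refine le_trans ?_ hvar
        rw [← sq_abs I]
        exact pow_le_pow_left₀ (mul_nonneg (by positivity) (sub_nonneg.2 h)) hIlow 2
      have h2 : r ^ 4 / 45 * (|d| - 3 * K * r ^ 2) ^ 2 ≤ V := by
        have h3 : (2 * r ^ 4 / 45 * (|d| - 3 * K * r ^ 2)) ^ 2 =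
            4 * r ^ 4 / 45 * (r ^ 4 / 45 * (|d| - 3 * K * r ^ 2) ^ 2) := by ring
        rw [h3] at h1
        exact le_of_mul_le_mul_left h1 (by positivity)
      refine le_trans ?_ h2
      refine mul_le_mul_of_nonneg_left ?_ (by positivity)
      nlinarith [sq_nonneg (3 * K * r ^ 2)]
    · refine le_trans (mul_nonpos_of_nonneg_of_nonpos (by positivity) ?_) hV
      have h1 : |d| * |d| ≤ |d| * (3 * K * r ^ 2) := mul_le_mul_of_nonneg_left h (abs_nonneg _)
      have h2 : 0 ≤ |d| * (3 * K * r ^ 2) := by positivity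
      nlinarith
  -- The bound `|d| ≤ C * w p ^ 2` turns the cross term into `6 * C ^ 2 * w p ^ 6 * r ^ 2`, within
  -- the stated `32 / 3`.
  refine le_trans (mul_le_mul_of_nonneg_left ?_ (by positivity)) hmain
  have h1 := mul_le_mul_of_nonneg_right hdK (sq_nonneg r)
  have h2 : 0 ≤ C ^ 2 * w p ^ 6 * r ^ 2 := by positivity
  nlinarith

end BoxVariance

/-! ### The explicit bound inside the patch, and size estimates for `ω`. -/

namespace QuantumLoss

variable {n m M : ℕ}

theorem curvature_nonneg (Q : QuantumLoss n m M) (φ : Fin m → ℝ) (p : Fin m) :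
    0 ≤ Q.curvature φ p := abs_nonneg _

theorem otherOmegaSq_nonneg (Q : QuantumLoss n m M) (p : Fin m) : 0 ≤ Q.otherOmegaSq p :=
  Finset.sum_nonneg fun _ _ => sq_nonneg _

theorem opNorm_O_nonneg (Q : QuantumLoss n m M) : 0 ≤ Q.O.opNorm := norm_nonneg _

/-- The radius condition with the denominator cleared. -/
theorem variance_bounds (Q : QuantumLoss n m M) (φ : Fin m → ℝ) (p : Fin m) {r : ℝ}
    (hr : 0 < r) (hc : 0 < Q.curvature φ p)
    (h : r ^ 2 * (8 * (16 * Q.curvature φ p * Q.O.opNorm * Q.omega p ^ 2 * Q.otherOmegaSq p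
      + 32 * Q.O.opNorm ^ 2 * Q.omega p ^ 6)) ≤ 9 * Q.curvature φ p ^ 2) :
    Q.varianceBound φ p r ≤ Q.lossVariance φ r ∧
      1 / 72 * Q.curvature φ p ^ 2 * r ^ 4 ≤ Q.varianceBound φ p r := by
  have hO := Q.opNorm_O_nonneg
  have hω := Q.omega_nonneg p
  have hS := Q.otherOmegaSq_nonneg p
  have hcross : 8 / 3 * Q.O.opNorm * Q.omega p ^ 2 * Q.otherOmegaSq p * r ^ 2 ≤
      Q.curvature φ p := by
    have h1 : 0 ≤ Q.O.opNorm ^ 2 * Q.omega p ^ 6 * r ^ 2 := by positivity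
    refine le_of_mul_le_mul_left ?_ hc
    nlinarith
  constructor
  · have hS' : Q.otherOmegaSq p = ∑ q ∈ Finset.univ.erase p, Q.omega q ^ 2 := by
      rw [otherOmegaSq, Finset.filter_ne']
    have key := (Q.loss_partialsBounded 4).variance_uniformBox_ge φ hr p
      (c := Q.curvature φ p) rfl (by rw [← hS']; exact hcross)
    rw [← hS'] at key
    exact key
  · rw [varianceBound]
    -- With `t` the subtracted term in the square and `v` the last term, the radius hypothesis reads
    -- `2 * c * t + v ≤ 3 / 8 * c ^ 2`. Hence `(c - t) ^ 2 - v ≥ 5 / 8 * c ^ 2`, and `5 / 8 / 45 = 1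
    -- / 72`.
    have h2 : 5 / 8 * Q.curvature φ p ^ 2 ≤
        (Q.curvature φ p - 8 / 3 * Q.O.opNorm * Q.omega p ^ 2 * Q.otherOmegaSq p * r ^ 2) ^ 2
          - 32 / 3 * Q.O.opNorm ^ 2 * Q.omega p ^ 6 * r ^ 2 := by
      have := sq_nonneg (8 / 3 * Q.O.opNorm * Q.omega p ^ 2 * Q.otherOmegaSq p * r ^ 2)
      nlinarith
    have h3 := mul_le_mul_of_nonneg_left h2 (by positivity : 0 ≤ r ^ 4 / 45)
    linarith

theorem omega_le (Q : QuantumLoss n m M) {c h : ℝ} (q : Fin m) (h0 : 0 ≤ h)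
    (hcard : ((Finset.univ.filter fun l => Q.S l = q).card : ℝ) ≤ c)
    (hH : ∀ l, (Q.H l).opNorm ≤ h) : Q.omega q ≤ c * (2 * h) := by
  have h1 := Finset.sum_le_card_nsmul (Finset.univ.filter fun l => Q.S l = q)
    (fun l => (Q.H l).maxFreq (Q.H_hermitian l)) (2 * h) fun l _ =>
      (QubitOp.maxFreq_le (Q.H_hermitian l)).trans (mul_le_mul_of_nonneg_left (hH l) two_pos.le)
  rw [nsmul_eq_mul] at h1
  exact h1.trans (mul_le_mul_of_nonneg_right hcard (by positivity))

theorem otherOmegaSq_le (Q : QuantumLoss n m M) (p : Fin m) {b : ℝ}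
    (hb : ∀ q, Q.omega q ≤ b) : Q.otherOmegaSq p ≤ m * b ^ 2 := by
  have h1 := Finset.sum_le_card_nsmul (Finset.univ.filter fun q => q ≠ p)
    (fun q => Q.omega q ^ 2) (b ^ 2) fun q _ =>
      pow_le_pow_left₀ (Q.omega_nonneg q) (hb q) 2
  rw [nsmul_eq_mul] at h1
  refine h1.trans (mul_le_mul_of_nonneg_right ?_ (sq_nonneg b))
  exact_mod_cast (Finset.card_le_univ _).trans_eq (Fintype.card_fin m)

end QuantumLoss

/-! ### Asymptotics and the main theorem. -/

/-- Here `X` stands for `n ^ a`. Relative to `c ^ 2`, the two denominator terms are of order `X ^ 10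
* m * r ^ 2` and at most `X ^ 16 * m * r ^ 2`; the larger power serves for both. The thresholds `32`
and `64` make each contribute at most `4 * c ^ 2`, so the sum stays below `9 * c ^ 2`. -/
theorem radius_condition_of_le {c o w s r m X A W E D F : ℝ} (hX : 1 ≤ X) (hm : 1 ≤ m)
    (hc : 0 < c) (ho : 0 ≤ o) (hw : 0 ≤ w) (hs : 0 ≤ s) (hA : 0 ≤ A) (hE : 0 ≤ E)
    (hoA : o ≤ A * X) (hwW : w ≤ W * X ^ 2) (hsW : s ≤ m * (W * X ^ 2) ^ 2)
    (hcE : 1 ≤ E * c * X) (hD : 0 < D)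
    (hrF : X ^ 16 * D * (r ^ 2 * m) ≤ F)
    (hD1 : 32 * (A * W ^ 4 * E * F) ≤ D) (hD2 : 64 * (A ^ 2 * W ^ 6 * E ^ 2 * F) ≤ D) :
    r ^ 2 * (8 * (16 * c * o * w ^ 2 * s + 32 * o ^ 2 * w ^ 6)) ≤ 9 * c ^ 2 := by
  have hX0 : 0 ≤ X := zero_le_one.trans hX
  have hm0 : 0 ≤ m := zero_le_one.trans hm
  have scale : ∀ {t : ℝ}, 0 ≤ t → t * F ≤ D → t * (X ^ 16 * (r ^ 2 * m)) ≤ 1 := by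
    intro t ht htF
    refine le_of_mul_le_mul_right ?_ hD
    calc t * (X ^ 16 * (r ^ 2 * m)) * D = t * (X ^ 16 * D * (r ^ 2 * m)) := by ring
      _ ≤ t * F := mul_le_mul_of_nonneg_left hrF ht
      _ ≤ 1 * D := by rwa [one_mul]
  have h1 : 32 * (A * W ^ 4 * E) * (X ^ 16 * (r ^ 2 * m)) ≤ 1 :=
    scale (by positivity) (le_trans (le_of_eq (by ring)) hD1)
  have h2 : 64 * (A ^ 2 * W ^ 6 * E ^ 2) * (X ^ 16 * (r ^ 2 * m)) ≤ 1 :=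
    scale (by positivity) (le_trans (le_of_eq (by ring)) hD2)
  have h3 : o * w ^ 2 * s * r ^ 2 ≤ c * (A * W ^ 4 * E * (X ^ 16 * (r ^ 2 * m))) := by
    calc o * w ^ 2 * s * r ^ 2
        ≤ (A * X) * (W * X ^ 2) ^ 2 * (m * (W * X ^ 2) ^ 2) * r ^ 2 := by gcongr
      _ = A * W ^ 4 * (r ^ 2 * m) * X ^ 9 * 1 := by ring
      _ ≤ A * W ^ 4 * (r ^ 2 * m) * X ^ 9 * (E * c * X) := by gcongr
      _ = A * W ^ 4 * (r ^ 2 * m) * E * c * X ^ 10 := by ring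
      _ ≤ A * W ^ 4 * (r ^ 2 * m) * E * c * X ^ 16 := by gcongr; norm_num
      _ = _ := by ring
  have h4 : o ^ 2 * w ^ 6 * r ^ 2 ≤ c ^ 2 * (A ^ 2 * W ^ 6 * E ^ 2 * (X ^ 16 * (r ^ 2 * m))) := by
    calc o ^ 2 * w ^ 6 * r ^ 2 ≤ (A * X) ^ 2 * (W * X ^ 2) ^ 6 * r ^ 2 := by gcongr
      _ = A ^ 2 * W ^ 6 * (r ^ 2 * 1) * X ^ 14 * 1 ^ 2 := by ring
      _ ≤ A ^ 2 * W ^ 6 * (r ^ 2 * m) * X ^ 14 * (E * c * X) ^ 2 := by gcongr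
      _ = _ := by ring
  have h5 : c * (o * w ^ 2 * s * r ^ 2) ≤ c * (c * (1 / 32)) := by
    refine mul_le_mul_of_nonneg_left (h3.trans (mul_le_mul_of_nonneg_left ?_ hc.le)) hc.le
    linarith
  have h6 : o ^ 2 * w ^ 6 * r ^ 2 ≤ c ^ 2 * (1 / 64) := by
    refine h4.trans (mul_le_mul_of_nonneg_left ?_ (sq_nonneg c))
    linarith
  nlinarith

theorem QuantumLoss.lossVariance_isBigO (a k : ℕ) (hk : 8 * a + 1 ≤ k) (m M : ℕ → ℕ)
    (Q : ∀ n : ℕ, QuantumLoss n (m n) (M n))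
    (φ : ∀ n : ℕ, Fin (m n) → ℝ) (p : ∀ n : ℕ, Fin (m n)) (r : ℕ → ℝ)
    (hO : (fun n : ℕ => (Q n).O.opNorm) =O[Filter.atTop] (fun n : ℕ => (n : ℝ) ^ a))
    (hH : ∃ C : ℝ, ∀ᶠ n : ℕ in Filter.atTop, ∀ l : Fin (M n),
      ((Q n).H l).opNorm ≤ C * (n : ℝ) ^ a)
    (hcard : ∃ C : ℝ, ∀ᶠ n : ℕ in Filter.atTop, ∀ q : Fin (m n),
      ((Finset.univ.filter (fun l => (Q n).S l = q)).card : ℝ) ≤ C * (n : ℝ) ^ a)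
    (hcurv : (fun n : ℕ => 1 / (n : ℝ) ^ a) =O[Filter.atTop]
      (fun n : ℕ => (Q n).curvature (φ n) (p n)))
    (hr : ∀ n : ℕ, 0 < r n)
    (hrΘ : r =Θ[Filter.atTop] (fun n : ℕ => 1 / ((n : ℝ) ^ k * √(m n : ℝ)))) :
    (fun n : ℕ => 1 / ((n : ℝ) ^ (2 * a + 4 * k) * (m n : ℝ) ^ 2)) =O[Filter.atTop]
      (fun n : ℕ => (Q n).lossVariance (φ n) (r n)) := by
  obtain ⟨A, hA0, hA⟩ := hO.exists_pos
  obtain ⟨B, hB⟩ := hH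
  obtain ⟨C, hC⟩ := hcard
  obtain ⟨E, hE0, hE⟩ := hcurv.exists_pos
  obtain ⟨F, hF0, hF⟩ := hrΘ.1.exists_pos
  obtain ⟨G, hG0, hG⟩ := hrΘ.2.exists_pos
  set W : ℝ := |C| * (2 * |B|) with hWdef
  set D : ℝ := 32 * (A * W ^ 4 * E * F ^ 2) + 64 * (A ^ 2 * W ^ 6 * E ^ 2 * F ^ 2) + 1 with hDdef
  have hD : 0 < D := by positivity
  refine Asymptotics.IsBigO.of_bound (72 * E ^ 2 * G ^ 4) ?_
  have hlarge : ∀ᶠ n : ℕ in Filter.atTop, max 1 D ≤ (n : ℝ) :=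
    tendsto_natCast_atTop_atTop.eventually_ge_atTop _
  filter_upwards [hA.bound, hB, hC, hE.bound, hF.bound, hG.bound, hlarge] with
    n hA hB hC hE hF hG hn
  have hx1 : (1 : ℝ) ≤ n := (le_max_left _ _).trans hn
  have hxD : D ≤ (n : ℝ) := (le_max_right _ _).trans hn
  -- The mere existence of the parameter `p n` forces `m n` to be positive.
  have hm : (1 : ℝ) ≤ m n := by exact_mod_cast (p n).pos
  set x : ℝ := (n : ℝ)
  set X : ℝ := x ^ a with hXdef
  set Y : ℝ := x ^ k with hYdef
  have hX : 1 ≤ X := one_le_pow₀ hx1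
  have hY : 1 ≤ Y := one_le_pow₀ hx1
  have hX0 : 0 < X := zero_lt_one.trans_le hX
  have hY0 : 0 < Y := zero_lt_one.trans_le hY
  have hm0 : (0 : ℝ) < m n := zero_lt_one.trans_le hm
  have hO0 := (Q n).opNorm_O_nonneg
  have hc0 := (Q n).curvature_nonneg (φ n) (p n)
  have hsqrt : 0 < √(m n : ℝ) := Real.sqrt_pos.2 hm0
  have hr0 := hr n
  rw [Real.norm_of_nonneg hO0, Real.norm_of_nonneg hX0.le] at hA
  rw [Real.norm_of_nonneg hc0, Real.norm_of_nonneg (by positivity), div_le_iff₀ hX0] at hE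
  rw [Real.norm_of_nonneg hr0.le, Real.norm_of_nonneg (by positivity), mul_one_div,
    le_div_iff₀ (by positivity)] at hF
  rw [Real.norm_of_nonneg hr0.le, Real.norm_of_nonneg (by positivity),
    div_le_iff₀ (by positivity)] at hG
  have hc : 0 < (Q n).curvature (φ n) (p n) := by
    refine hc0.lt_of_ne fun h => ?_
    rw [← h] at hE
    norm_num at hE
  have hω : ∀ q, (Q n).omega q ≤ W * X ^ 2 := fun q => by
    have := (Q n).omega_le (c := |C| * X) (h := |B| * X) q (by positivity)
      ((hC q).trans (mul_le_mul_of_nonneg_right (le_abs_self C) hX0.le))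
      fun l => (hB l).trans (mul_le_mul_of_nonneg_right (le_abs_self B) hX0.le)
    exact this.trans_eq (by rw [hWdef]; ring)
  have hr2 : r n ^ 2 * m n * Y ^ 2 ≤ F ^ 2 := by
    have := pow_le_pow_left₀ (by positivity) hF 2
    rwa [mul_pow, mul_pow, Real.sq_sqrt hm0.le, mul_comm (Y ^ 2), ← mul_assoc] at this
  -- This is the origin of `8 * a + 1`: the requirement `16 * a + 2 ≤ 2 * k` leaves a spare factor
  -- `n ^ 2` to absorb the constant `D`.
  have hXY : X ^ 16 * D ≤ Y ^ 2 := by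
    calc X ^ 16 * D ≤ X ^ 16 * x ^ 2 := by
          gcongr
          exact hxD.trans (le_self_pow₀ hx1 two_ne_zero)
      _ = x ^ (16 * a + 2) := by rw [hXdef]; ring
      _ ≤ x ^ (2 * k) := pow_le_pow_right₀ hx1 (by omega)
      _ = Y ^ 2 := by rw [hYdef]; ring
  have hcond := radius_condition_of_le (F := F ^ 2) hX hm hc hO0 ((Q n).omega_nonneg (p n))
    ((Q n).otherOmegaSq_nonneg (p n)) hA0.le hE0.le hA (hω (p n))
    ((Q n).otherOmegaSq_le (p n) hω) hE hD (r := r n)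
    ((mul_le_mul_of_nonneg_right hXY (by positivity)).trans
      (le_trans (le_of_eq (by ring)) hr2))
    (by
      have : 0 ≤ 64 * (A ^ 2 * W ^ 6 * E ^ 2 * F ^ 2) := by positivity
      linarith)
    (by
      have : 0 ≤ 32 * (A * W ^ 4 * E * F ^ 2) := by positivity
      linarith)
  obtain ⟨hv1, hv2⟩ := (Q n).variance_bounds (φ n) (p n) hr0 hc hcond
  have hv := hv2.trans hv1
  refine (Real.norm_of_nonneg (by positivity)).trans_le ?_
  refine le_trans ?_ (mul_le_mul_of_nonneg_left (hv.trans (Real.le_norm_self _)) (by positivity))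
  have hr4 : 1 ≤ G ^ 4 * r n ^ 4 * (Y ^ 4 * (m n : ℝ) ^ 2) := by
    have := pow_le_pow_left₀ zero_le_one hG 4
    rw [one_pow, mul_pow, mul_pow, mul_pow,
      show √(m n : ℝ) ^ 4 = (√(m n : ℝ) ^ 2) ^ 2 by ring, Real.sq_sqrt hm0.le] at this
    exact this
  have hc2 : 1 ≤ E ^ 2 * (Q n).curvature (φ n) (p n) ^ 2 * X ^ 2 := by
    have := pow_le_pow_left₀ zero_le_one hE 2
    rwa [one_pow, mul_pow, mul_pow] at this
  rw [div_le_iff₀ (by positivity), show x ^ (2 * a + 4 * k) = X ^ 2 * Y ^ 4 by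
    rw [hXdef, hYdef]; ring]
  calc (1 : ℝ) ≤ (E ^ 2 * (Q n).curvature (φ n) (p n) ^ 2 * X ^ 2) *
        (G ^ 4 * r n ^ 4 * (Y ^ 4 * (m n : ℝ) ^ 2)) := one_le_mul_of_one_le_of_one_le hc2 hr4
    _ = _ := by ring

theorem QuantumLoss.variance_bounds_of_le_patchRadiusSq {n m M : ℕ} (Q : QuantumLoss n m M)
    (φ : Fin m → ℝ) (p : Fin m) {r : ℝ} (hr : 0 < r) (h : r ^ 2 ≤ Q.patchRadiusSq φ p) :
    Q.varianceBound φ p r ≤ Q.lossVariance φ r ∧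
      1 / 72 * Q.curvature φ p ^ 2 * r ^ 4 ≤ Q.varianceBound φ p r := by
  have hpos : 0 < Q.patchRadiusSq φ p := (pow_pos hr 2).trans_le h
  have hO := Q.opNorm_O_nonneg
  have hω := Q.omega_nonneg p
  have hS := Q.otherOmegaSq_nonneg p
  have hc := Q.curvature_nonneg φ p
  rw [patchRadiusSq] at h hpos
  have hc' : 0 < Q.curvature φ p := by
    refine hc.lt_of_ne fun h0 => ?_
    rw [← h0] at hpos
    norm_num at hpos
  refine Q.variance_bounds φ p hr hc' ((le_div_iff₀ ?_).1 h)
  -- A vanishing denominator would give patch radius zero by the division convention, contradicting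
  -- `0 < r`.
  refine lt_of_le_of_ne (by positivity) fun h0 => ?_
  rw [← h0, div_zero] at hpos
  exact lt_irrefl _ hpos

theorem mainTheorem2 :
    (∀ (n m M : ℕ) (Q : QuantumLoss n m M) (φ : Fin m → ℝ) (p : Fin m) (r : ℝ),
      0 < r → r ^ 2 ≤ Q.patchRadiusSq φ p →
        Q.varianceBound φ p r ≤ Q.lossVariance φ r ∧
        1 / 72 * Q.curvature φ p ^ 2 * r ^ 4 ≤ Q.varianceBound φ p r) ∧
    (∀ a : ℕ, ∃ k₀ : ℕ, ∀ k : ℕ, k₀ ≤ k → ∃ j : ℕ,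
      ∀ (m M : ℕ → ℕ) (Q : ∀ n : ℕ, QuantumLoss n (m n) (M n))
        (φ : ∀ n : ℕ, Fin (m n) → ℝ) (p : ∀ n : ℕ, Fin (m n)) (r : ℕ → ℝ),
        (fun n : ℕ => (Q n).O.opNorm) =O[Filter.atTop] (fun n : ℕ => (n : ℝ) ^ a) →
        (∃ C : ℝ, ∀ᶠ n : ℕ in Filter.atTop, ∀ l : Fin (M n),
          ((Q n).H l).opNorm ≤ C * (n : ℝ) ^ a) →
        (∃ C : ℝ, ∀ᶠ n : ℕ in Filter.atTop, ∀ q : Fin (m n),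
          ((Finset.univ.filter (fun l => (Q n).S l = q)).card : ℝ) ≤ C * (n : ℝ) ^ a) →
        (fun n : ℕ => 1 / (n : ℝ) ^ a) =O[Filter.atTop]
          (fun n : ℕ => (Q n).curvature (φ n) (p n)) →
        (∀ n : ℕ, 0 < r n) →
        r =Θ[Filter.atTop] (fun n : ℕ => 1 / ((n : ℝ) ^ k * √(m n : ℝ))) →
        (fun n : ℕ => 1 / ((n : ℝ) ^ j * (m n : ℝ) ^ 2)) =O[Filter.atTop]
          (fun n : ℕ => (Q n).lossVariance (φ n) (r n))) := by
  refine ⟨fun n m M Q φ p r hr h => Q.variance_bounds_of_le_patchRadiusSq φ p hr h,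
    -- The exponent `2 * a + 4 * k` is read off from `c_p ^ 2 * r ^ 4`, with `c_p` at least of order
    -- `n ^ (-a)` and `r` of order `n ^ (-k) / √m`.
    fun a => ⟨8 * a + 1, fun k hk => ⟨2 * a + 4 * k, ?_⟩⟩⟩
  exact QuantumLoss.lossVariance_isBigO a k hk
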